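/- **Theorem 4.1.** A *lattice multi-polygon* $\mathcal P$ is a finite cyclic sequence of points $v_1,\dots,v_d\in\mathbb Z^2$ ($d\ge 2$, $v_{d+1}=v_1$, $v_i\neq v_{i+1}$ for all $i$, indices modulo $d$), regarded as an oriented piecewise linear loop with sides $v_iv_{i+1}$, together with a sign $\epsilon(v_iv_{i+1})\in\{+1,-1\}$ for each side, such that whenever three consecutive points $v_{i-1},v_i,v_{i+1}$ lie on a line, 1. $\epsilon(v_{i-1}v_i)=\epsilon(v_iv_{i+1})$ if $v_i$ is between $v_{i-1}$ and $v_{i+1}$; 2. $\epsilon(v_{i-1}v_i)\ne\epsilon(v_iv_{i+1})$ if $v_{i-1}$ lies on the segment $v_iv_{i+1}$ or $v_{i+1}$ lies on the segment $v_{i-1}v_i$. For such $\mathcal P$ let $d_{\mathcal P}(v)$ be the winding number of the loop around a point $v\in\mathbb R^2$ not on it, let $|v_iv_{i+1}|$ be the number of lattice points on the segment $v_iv_{i+1}$ minus $1$, and let $n_i$ be a normal vector to $v_iv_{i+1}$ such that the counterclockwise rotation by $90$ degrees of $\epsilon(v_iv_{i+1})\,n_i$ has the direction from $v_i$ to $v_{i+1}$.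 (By 1 and 2, consecutive normals $n_i,n_{i+1}$ never point in opposite directions.) Put $$A(\mathcal P)=\int_{\mathbb R^2\setminus\mathcal P}d_{\mathcal P}(v)\,dv,\qquad B(\mathcal P)=\sum_{i=1}^d\epsilon(v_iv_{i+1})\,|v_iv_{i+1}|,$$ and let $C(\mathcal P)$ be the rotation number around the origin of the cyclic sequence $n_1,\dots,n_d$, that is, $\frac1{2\pi}$ times the sum over $i$ of the signed angles in $(-\pi,\pi)$ from $n_i$ to $n_{i+1}$ (with $n_{d+1}=n_1$). Then, for real numbers $a,b,c$, there is a lattice multi-polygon $\mathcal P$ with $$(a,b,c)=\bigl(A(\mathcal P),\tfrac12B(\mathcal P),C(\mathcal P)\bigr)$$ if and only if $a,b\in\tfrac12\mathbb Z$, $c\in\mathbb Z$ and $a+b\in\mathbb Z$. -/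

import Mathlib

noncomputable section

/-- The point of the plane `ℝ² = ℂ` with the given integer coordinates. -/
def latticePoint (p : ℤ × ℤ) : ℂ := ⟨(p.1 : ℝ), (p.2 : ℝ)⟩

/-- The rotation number around the origin of a cyclic sequence of nonzero plane vectors
`z₁, …, z_d` (with `z_{d+1} = z₁`) in which no two consecutive vectors point in opposite
directions: the total angle swept, counterclockwise counted positive, divided by `2π`, where from
`z_i` to `z_{i+1}` one turns through the angle between them in `(-π, π)`. -/
def rotationNumber {d : ℕ} (z : Fin d → ℂ) : ℝ :=
  (∑ i, Complex.arg (z (finRotate d i) / z i)) / (2 * Real.pi)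

/-- A lattice multi-polygon: a cyclic sequence of lattice points, consecutive ones being distinct,
with a sign on each side. The side with index `i` goes from vertex `i` to the cyclically next vertex
`finRotate d i`. -/
structure LatticeMultiPolygon where
  d : ℕ
  two_le : 2 ≤ d
  vertex : Fin d → ℤ × ℤ
  sign : Fin d → ℤˣ
  vertex_ne : ∀ i, vertex i ≠ vertex (finRotate d i)
  /-- If the middle one of three consecutive points lies between the other two, then the two sides
  meeting there have equal signs. -/
  sign_eq : ∀ i,
    latticePoint (vertex (finRotate d i)) ∈
      segment ℝ (latticePoint (vertex i)) (latticePoint (vertex (finRotate d (finRotate d i)))) →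
    sign i = sign (finRotate d i)
  /-- If the first of three consecutive points lies on the second side, or the third one lies on
  the first side, then the two sides have different signs. -/
  sign_ne : ∀ i,
    (latticePoint (vertex i) ∈
        segment ℝ (latticePoint (vertex (finRotate d i)))
          (latticePoint (vertex (finRotate d (finRotate d i)))) ∨
      latticePoint (vertex (finRotate d (finRotate d i))) ∈
        segment ℝ (latticePoint (vertex i)) (latticePoint (vertex (finRotate d i)))) →
    sign i ≠ sign (finRotate d i)

namespace LatticeMultiPolygon

variable (P : LatticeMultiPolygon)

/-- The `i`-th vertex as a point of the plane. -/
def point (i : Fin P.d) : ℂ := latticePoint (P.vertex i)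

/-- The `i`-th side as a subset of the plane. -/
def side (i : Fin P.d) : Set ℂ := segment ℝ (P.point i) (P.point (finRotate P.d i))

/-- The union of all the sides. -/
def loop : Set ℂ := ⋃ i, P.side i

/-- The number of lattice points on the `i`-th side, minus one. -/
def sideLength (i : Fin P.d) : ℤ := ({p : ℤ × ℤ | latticePoint p ∈ P.side i}.ncard : ℤ) - 1

/-- The normal vector `n_i` to the `i`-th side for which the counterclockwise 90 degree rotation of
`sign i • n_i` has the direction of the side. -/
def normal (i : Fin P.d) : ℂ :=
  ((P.sign i : ℤ) : ℂ) * (-Complex.I * (P.point (finRotate P.d i) - P.point i))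

/-- The winding number of the oriented loop around a point `p` not on it. Seen from `p`, the vector
to a point moving along a side turns through an angle in `(-π, π)`, so the winding number is the
rotation number of the vectors from `p` to the vertices. -/
def windingNumber (p : ℂ) : ℝ := rotationNumber fun i => P.point i - p

/-- The integral of the winding number over the complement of the loop. -/
def A : ℝ := ∫ p in P.loopᶜ, P.windingNumber p

/-- The sum of the signed lattice lengths of the sides. -/
def B : ℤ := ∑ i, (P.sign i : ℤ) * P.sideLength i

/-- The rotation number of the sequence of normal vectors. -/
def C : ℝ := rotationNumber P.normal

end LatticeMultiPolygon

end

/-!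
The theorem rests on three facts about a lattice multi-polygon with vertices `vᵢ`.

* *Area formula* (`LatticeMultiPolygon.A_eq_sum_wedge`): `2A = ∑ vᵢ × vᵢ₊₁`. Off finitely many
  segments, the winding number is the sum over the sides of the winding numbers of the triangles
  `0, vᵢ, vᵢ₊₁`, because the angles belonging to the segments `0vᵢ` cancel. The three angles of a
  triangle add up to `±2π` or to `0` according to the orientations seen from the point
  (`turn_add_turn_add_turn`), so that the winding number of a triangle is, up to sign, the indicator
  function of its interior, whose area is given by a determinant (`volume_ccwTriangle`).
* *Parity* (`LatticeMultiPolygon.even_doubleArea_add_B`): the lattice length of a side is the greatest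
  common divisor of the coordinates `x, y` of the vector along it, which is congruent to
  `x + y + xy` modulo `2`. Hence `2A + B` is congruent to a telescoping cyclic sum. This
  gives `A + B / 2 ∈ ℤ`, while the rotation number is an integer since the angles telescope
  modulo `2π`.
* *Additivity* (`Attained.add`): two multi-polygons with the same first side, with the same sign, can
  be run through one after the other, and then `A`, `B` and `C` add up. The triangles with vertices
  `(0, 0)`, `(1, 0)`, `(0, ±1)` and all choices of signs on the last two sides
  (`attained_triangle`) have values of `(2A, B, C)` that generate, under addition alone, all triples
  `(k, l, m)` of integers with `k + l` even.
-/

open MeasureTheory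

/-! ### Signed angles between plane vectors -/

/-- The determinant of two plane vectors: twice the signed area of the triangle they span. -/
def wedge (u v : ℂ) : ℝ := u.re * v.im - u.im * v.re

/-- The signed angle, in `(-π, π]`, from `u` to `v`. -/
noncomputable def turn (u v : ℂ) : ℝ := (v / u).arg

lemma wedge_swap (u v : ℂ) : wedge v u = -wedge u v := by
  unfold wedge; ring

lemma im_div_eq_wedge (u v : ℂ) : (v / u).im = wedge u v / Complex.normSq u := by
  rw [Complex.div_im, wedge]; ring

lemma turn_neg_iff {u v : ℂ} (hu : u ≠ 0) : turn u v < 0 ↔ wedge u v < 0 := by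
  have h := Complex.normSq_pos.2 hu
  rw [turn, Complex.arg_neg_iff, im_div_eq_wedge, div_lt_iff₀ h, zero_mul]

lemma turn_swap {u v : ℂ} (h : turn u v ≠ Real.pi) : turn v u = -turn u v := by
  unfold turn at *
  rw [← inv_div v u, Complex.arg_inv, if_neg h]

lemma turn_pos_iff {u v : ℂ} (hv : v ≠ 0) (h : turn u v ≠ Real.pi) :
    0 < turn u v ↔ 0 < wedge u v := by
  have h1 := turn_swap h
  have h2 := wedge_swap u v
  have h3 := turn_neg_iff (v := u) hv
  rw [h1, h2] at h3
  simpa using h3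

lemma turn_lt_pi {u v : ℂ} (h : turn u v ≠ Real.pi) : turn u v < Real.pi :=
  lt_of_le_of_ne (Complex.arg_le_pi _) h

lemma turn_coe_angle {u v : ℂ} (hu : u ≠ 0) (hv : v ≠ 0) :
    (turn u v : Real.Angle) = (v.arg : Real.Angle) - u.arg :=
  Complex.arg_div_coe_angle hv hu

lemma turn_ne_pi_of_wedge_ne_zero {u v : ℂ} (h : wedge u v ≠ 0) : turn u v ≠ Real.pi := by
  intro hp
  have h0 := (Complex.arg_eq_pi_iff.1 hp).2
  rw [im_div_eq_wedge, div_eq_zero_iff] at h0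
  rcases h0 with h0 | h0
  · exact h h0
  · rw [Complex.normSq_eq_zero] at h0
    simp [wedge, h0] at h

/-- The rotation number around `0` of a closed sequence of three vectors, in terms of the
orientations of the three pairs of consecutive vectors: a full turn needs three turns in the same
direction. -/
lemma turn_add_turn_add_turn {u v w : ℂ} (hu : u ≠ 0) (hv : v ≠ 0) (hw : w ≠ 0)
    (huv : turn u v ≠ Real.pi) (hvw : turn v w ≠ Real.pi) (hwu : turn w u ≠ Real.pi) :
    turn u v + turn v w + turn w u = 2 * Real.pi *
      ((if 0 < wedge u v ∧ 0 < wedge v w ∧ 0 < wedge w u then 1 else 0) -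
        (if wedge u v < 0 ∧ wedge v w < 0 ∧ wedge w u < 0 then 1 else 0)) := by
  have hz : ((turn u v + turn v w + turn w u : ℝ) : Real.Angle) = 0 := by
    rw [Real.Angle.coe_add, Real.Angle.coe_add, turn_coe_angle hu hv, turn_coe_angle hv hw,
      turn_coe_angle hw hu]
    abel
  obtain ⟨n, hn⟩ := Real.Angle.coe_eq_zero_iff.1 hz
  rw [zsmul_eq_mul] at hn
  simp only [← turn_pos_iff hv huv, ← turn_pos_iff hw hvw, ← turn_pos_iff hu hwu,
    ← turn_neg_iff hu, ← turn_neg_iff hv, ← turn_neg_iff hw]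
  have a1 := turn_lt_pi huv
  have a2 := turn_lt_pi hvw
  have a3 := turn_lt_pi hwu
  have b1 : -Real.pi < turn u v := Complex.neg_pi_lt_arg _
  have b2 : -Real.pi < turn v w := Complex.neg_pi_lt_arg _
  have b3 : -Real.pi < turn w u := Complex.neg_pi_lt_arg _
  have hpi := Real.pi_pos
  rw [← hn]
  have hlt : ∀ k : ℤ, (n : ℝ) * (2 * Real.pi) < k * (2 * Real.pi) → n < k := fun k hk => by
    exact_mod_cast lt_of_mul_lt_mul_right hk (by positivity)
  have hgt : ∀ k : ℤ, (k : ℝ) * (2 * Real.pi) < n * (2 * Real.pi) → k < n := fun k hk => by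
    exact_mod_cast lt_of_mul_lt_mul_right hk (by positivity)
  split_ifs with hp hm hm
  · linarith [hp.1, hm.1]
  · have : n = 1 := by
      have h1 := hlt 2 (by push_cast; linarith)
      have h2 := hgt 0 (by push_cast; linarith [hp.1, hp.2.1, hp.2.2])
      omega
    rw [this]; push_cast; ring
  · have : n = -1 := by
      have h1 := hlt 0 (by push_cast; linarith [hm.1, hm.2.1, hm.2.2])
      have h2 := hgt (-2) (by push_cast; linarith)
      omega
    rw [this]; push_cast; ring
  · have hb : -(2 * Real.pi) < turn u v + turn v w + turn w u ∧
        turn u v + turn v w + turn w u < 2 * Real.pi := by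
      by_contra hcon
      rw [not_and_or, not_lt, not_lt] at hcon
      -- A sum of absolute value at least `2π` leaves room for no term of the other sign.
      rcases hcon with h | h
      · exact hm ⟨by linarith, by linarith, by linarith⟩
      · exact hp ⟨by linarith, by linarith, by linarith⟩
    have : n = 0 := by
      have h1 := hlt 1 (by push_cast; linarith [hb.2])
      have h2 := hgt (-1) (by push_cast; linarith [hb.1])
      omega
    rw [this]; push_cast; ring

lemma rotationNumber_eq_sum_turn {d : ℕ} (z : Fin d → ℂ) :
    rotationNumber z = (∑ i, turn (z i) (z (finRotate d i))) / (2 * Real.pi) := rfl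

/-- Modulo `2π` the angles of a closed sequence telescope to `0`. -/
lemma exists_rotationNumber_eq_intCast {d : ℕ} (z : Fin d → ℂ) (hz : ∀ i, z i ≠ 0) :
    ∃ m : ℤ, rotationNumber z = m := by
  have h0 : ((∑ i, turn (z i) (z (finRotate d i)) : ℝ) : Real.Angle) = 0 := by
    rw [← Real.Angle.coe_coeHom, map_sum]
    simp only [Real.Angle.coe_coeHom, turn_coe_angle (hz _) (hz _)]
    rw [Finset.sum_sub_distrib,
      Equiv.sum_comp (finRotate d) (fun i => ((z i).arg : Real.Angle)), sub_self]
  obtain ⟨n, hn⟩ := Real.Angle.coe_eq_zero_iff.1 h0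
  refine ⟨n, ?_⟩
  rw [rotationNumber_eq_sum_turn, ← hn, zsmul_eq_mul, mul_div_assoc, div_self, mul_one]
  exact Real.two_pi_pos.ne'

/-! ### The area of a triangle -/

/-- The open triangle with vertices `0`, `v`, `w`, if these are in counterclockwise order; the empty
set otherwise. -/
def ccwTriangle (v w : ℂ) : Set ℂ :=
  {p | 0 < wedge (v - p) (w - p) ∧ 0 < wedge (w - p) (0 - p) ∧ 0 < wedge (0 - p) (v - p)}

lemma measurableSet_ccwTriangle (v w : ℂ) : MeasurableSet (ccwTriangle v w) := by
  have h : IsOpen (ccwTriangle v w) := by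
    have hc : ∀ f g : ℂ → ℂ, Continuous f → Continuous g → IsOpen {p | 0 < wedge (f p) (g p)} :=
      fun f g hf hg => isOpen_lt continuous_const (by unfold wedge; fun_prop)
    exact (hc _ _ (by fun_prop) (by fun_prop)).inter
      ((hc _ _ (by fun_prop) (by fun_prop)).inter (hc _ _ (by fun_prop) (by fun_prop)))
  exact h.measurableSet

lemma volume_standardTriangle :
    volume {z : ℂ | 0 < z.re ∧ 0 < z.im ∧ z.re + z.im < 1} = ENNReal.ofReal (1 / 2) := by
  have hset : {z : ℂ | 0 < z.re ∧ 0 < z.im ∧ z.re + z.im < 1} =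
      Complex.measurableEquivRealProd ⁻¹'
        regionBetween (fun _ => 0) (fun x : ℝ => 1 - x) (Set.Ioc 0 1) := by
    ext z
    simp only [Set.mem_ofPred_eq, regionBetween, Set.mem_preimage,
      Complex.measurableEquivRealProd_apply, Set.mem_Ioc, Set.mem_Ioo]
    constructor
    · rintro ⟨h1, h2, h3⟩
      exact ⟨⟨h1, by linarith⟩, h2, by linarith⟩
    · rintro ⟨⟨h1, _⟩, h2, h3⟩
      exact ⟨h1, h2, by linarith⟩
  rw [hset, Complex.volume_preserving_equiv_real_prod.measure_preimage_equiv, Measure.volume_eq_prod,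
    volume_regionBetween_eq_integral]
  · congr 1
    rw [← intervalIntegral.integral_of_le zero_le_one]
    have : (((fun x : ℝ => 1 - x) - fun _ => (0 : ℝ))) = fun x : ℝ => 1 - x := by
      ext x; simp
    rw [this, intervalIntegral.integral_sub (by simp) (by simp)]
    norm_num
  · exact integrableOn_zero
  · exact (Continuous.integrableOn_Icc (by fun_prop)).mono_set Set.Ioc_subset_Icc_self
  · exact measurableSet_Ioc
  · intro x hx
    linarith [hx.2]

lemma volume_ccwTriangle (v w : ℂ) :
    volume (ccwTriangle v w) = ENNReal.ofReal (wedge v w / 2) := by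
  rcases le_or_gt (wedge v w) 0 with h | h
  · rw [ENNReal.ofReal_of_nonpos (by linarith)]
    convert measure_empty (μ := volume)
    rw [Set.eq_empty_iff_forall_notMem]
    rintro p ⟨h1, h2, h3⟩
    -- The three determinants add up to `wedge v w`.
    simp only [wedge, Complex.sub_re, Complex.sub_im, Complex.zero_re, Complex.zero_im] at *
    nlinarith
  · -- The triangle is the image of the standard one under the linear map `1 ↦ v`, `I ↦ w`.
    set f := Matrix.toLin Complex.basisOneI Complex.basisOneI !![v.re, w.re; v.im, w.im] with hf
    have hdet : LinearMap.det f = wedge v w := by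
      rw [hf, LinearMap.det_toLin, Matrix.det_fin_two_of, wedge]; ring
    have hfz : ∀ z : ℂ, f z = ⟨z.re * v.re + z.im * w.re, z.re * v.im + z.im * w.im⟩ := by
      intro z
      rw [hf, Matrix.toLin_apply]
      apply Complex.ext <;> simp [Fin.sum_univ_two, Matrix.mulVec, dotProduct] <;> ring
    have hpre : f ⁻¹' ccwTriangle v w = {z : ℂ | 0 < z.re ∧ 0 < z.im ∧ z.re + z.im < 1} := by
      ext z
      have e1 : wedge (v - f z) (w - f z) = (1 - (z.re + z.im)) * wedge v w := by
        simp [hfz, wedge]; ring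
      have e2 : wedge (w - f z) (0 - f z) = z.re * wedge v w := by
        simp [hfz, wedge]; ring
      have e3 : wedge (0 - f z) (v - f z) = z.im * wedge v w := by
        simp [hfz, wedge]; ring
      simp only [Set.mem_preimage, ccwTriangle, Set.mem_ofPred_eq, e1, e2, e3,
        mul_pos_iff_of_pos_right h, sub_pos]
      tauto
    have hvol := Measure.addHaar_preimage_linearMap volume (f := f) (by rw [hdet]; exact h.ne')
      (ccwTriangle v w)
    rw [hpre, volume_standardTriangle, hdet, abs_of_pos (inv_pos.2 h)] at hvol
    have : ENNReal.ofReal (wedge v w) * ENNReal.ofReal (1 / 2) = volume (ccwTriangle v w) := by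
      rw [hvol, ← mul_assoc, ← ENNReal.ofReal_mul h.le, mul_inv_cancel₀ h.ne', ENNReal.ofReal_one,
        one_mul]
    rw [← this, ← ENNReal.ofReal_mul h.le]
    congr 1; ring

/-! ### The area formula -/

lemma volume_segment (a b : ℂ) : volume (segment ℝ a b) = 0 := by
  refine measure_mono_null (t := (affineSpan ℝ {a, b} : Set ℂ)) ?_ ?_
  · rw [← convexHull_pair]
    exact convexHull_subset_affineSpan _
  · apply Measure.addHaar_affineSubspace
    intro htop
    have h1 := (collinear_iff_finrank_le_one.1 (collinear_pair ℝ a b))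
    rw [← direction_affineSpan, htop, AffineSubspace.direction_top, finrank_top,
      Complex.finrank_real_complex] at h1
    omega

/-- Seen from a point off the segment `ab`, the end points do not lie in opposite directions. -/
lemma turn_sub_sub_ne_pi {a b p : ℂ} (h : p ∉ segment ℝ a b) : turn (a - p) (b - p) ≠ Real.pi := by
  intro hp
  obtain ⟨hre, him⟩ := Complex.arg_eq_pi_iff.1 hp
  have hap : a - p ≠ 0 := by
    intro h0
    simp [h0] at hre
  set t := -((b - p) / (a - p)).re with ht
  have htpos : 0 < t := by linarith
  have hb : b - p = -t * (a - p) := by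
    have : (b - p) / (a - p) = (-t : ℂ) := by
      apply Complex.ext <;> simp [ht, him]
    rw [← this, div_mul_cancel₀ _ hap]
  apply h
  refine ⟨t / (1 + t), 1 / (1 + t), by positivity, by positivity, by field_simp; ring, ?_⟩
  have h1 : (1 + t : ℂ) ≠ 0 := by
    have : (1 + t : ℝ) ≠ 0 := by positivity
    exact_mod_cast this
  simp only [Complex.real_smul]
  push_cast
  field_simp
  linear_combination hb

lemma sub_ne_zero_of_notMem_segment {a b p : ℂ} (h : p ∉ segment ℝ a b) : a - p ≠ 0 := by
  rw [sub_ne_zero]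
  rintro rfl
  exact h (left_mem_segment ℝ _ _)

/-- The total angle around `p` of the closed path `0, v, w` is `2π` times the difference of two
indicator functions, at most one of which is not zero. -/
lemma triangle_turn_eq {v w p : ℂ} (hv : p ∉ segment ℝ 0 v) (hw : p ∉ segment ℝ 0 w)
    (hvw : p ∉ segment ℝ v w) :
    turn (v - p) (w - p) + turn (w - p) (0 - p) + turn (0 - p) (v - p) = 2 * Real.pi *
      ((ccwTriangle v w).indicator (fun _ => (1 : ℝ)) p -
        (ccwTriangle w v).indicator (fun _ => (1 : ℝ)) p) := by
  have hw' : p ∉ segment ℝ w 0 := by rwa [segment_symm]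
  rw [turn_add_turn_add_turn (sub_ne_zero_of_notMem_segment hvw)
    (sub_ne_zero_of_notMem_segment hw') (sub_ne_zero_of_notMem_segment hv)
    (turn_sub_sub_ne_pi hvw) (turn_sub_sub_ne_pi hw') (turn_sub_sub_ne_pi hv)]
  classical
  simp only [Set.indicator_apply, ccwTriangle, Set.mem_ofPred_eq]
  congr 2
  refine if_congr ?_ rfl rfl
  rw [wedge_swap (v - p) (w - p), wedge_swap (w - p) (0 - p), wedge_swap (0 - p) (v - p)]
  simp only [Left.neg_pos_iff]
  tauto

lemma integrable_indicator_ccwTriangle (v w : ℂ) :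
    Integrable ((ccwTriangle v w).indicator (fun _ => (1 : ℝ))) := by
  rw [integrable_indicator_iff (measurableSet_ccwTriangle v w)]
  apply integrableOn_const
  · rw [volume_ccwTriangle]; exact ENNReal.ofReal_ne_top
  · simp

lemma integral_indicator_ccwTriangle_sub (v w : ℂ) :
    ∫ p, ((ccwTriangle v w).indicator (fun _ => (1 : ℝ)) p -
      (ccwTriangle w v).indicator (fun _ => (1 : ℝ)) p) = wedge v w / 2 := by
  rw [integral_sub (integrable_indicator_ccwTriangle v w) (integrable_indicator_ccwTriangle w v),
    integral_indicator_const _ (measurableSet_ccwTriangle v w),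
    integral_indicator_const _ (measurableSet_ccwTriangle w v), Measure.real, Measure.real,
    volume_ccwTriangle, volume_ccwTriangle, wedge_swap v w]
  simp only [smul_eq_mul, mul_one]
  rcases le_total 0 (wedge v w) with h | h
  · rw [ENNReal.toReal_ofReal (by linarith), ENNReal.ofReal_of_nonpos (by linarith)]; simp
  · rw [ENNReal.toReal_ofReal (by linarith : 0 ≤ -wedge v w / 2),
      ENNReal.ofReal_of_nonpos (by linarith)]
    simp; ring

namespace LatticeMultiPolygon

variable (P : LatticeMultiPolygon)

lemma volume_loop : volume P.loop = 0 :=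
  measure_iUnion_null fun _ => volume_segment _ _

/-- Off finitely many segments, the winding number of the loop is the sum of the winding numbers
of the triangles spanned by the origin and the sides. -/
lemma windingNumber_eq_sum {p : ℂ} (h0 : ∀ i, p ∉ segment ℝ 0 (P.point i))
    (hs : p ∉ P.loop) :
    P.windingNumber p = ∑ i,
      ((ccwTriangle (P.point i) (P.point (finRotate P.d i))).indicator (fun _ => (1 : ℝ)) p -
        (ccwTriangle (P.point (finRotate P.d i)) (P.point i)).indicator (fun _ => (1 : ℝ)) p) := by
  rw [windingNumber, rotationNumber_eq_sum_turn, div_eq_iff Real.two_pi_pos.ne', Finset.sum_mul]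
  have hs' : ∀ i, p ∉ segment ℝ (P.point i) (P.point (finRotate P.d i)) := fun i hi =>
    hs (Set.mem_iUnion.2 ⟨i, hi⟩)
  have key : ∀ i, ((ccwTriangle (P.point i) (P.point (finRotate P.d i))).indicator
        (fun _ => (1 : ℝ)) p -
        (ccwTriangle (P.point (finRotate P.d i)) (P.point i)).indicator (fun _ => (1 : ℝ)) p) *
        (2 * Real.pi) = turn (P.point i - p) (P.point (finRotate P.d i) - p) +
        (turn (0 - p) (P.point i - p) - turn (0 - p) (P.point (finRotate P.d i) - p)) := by
    intro i
    rw [mul_comm, ← triangle_turn_eq (h0 i) (h0 _) (hs' i),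
      turn_swap (turn_sub_sub_ne_pi (h0 (finRotate P.d i)))]
    ring
  -- The sides issuing from the origin cancel in pairs.
  rw [Finset.sum_congr rfl fun i _ => key i, Finset.sum_add_distrib, Finset.sum_sub_distrib,
    Equiv.sum_comp (finRotate P.d) (fun i => turn (0 - p) (P.point i - p)), sub_self, add_zero]

theorem A_eq_sum_wedge : P.A = (∑ i, wedge (P.point i) (P.point (finRotate P.d i))) / 2 := by
  have hfull : (P.loopᶜ : Set ℂ) =ᵐ[volume] (Set.univ : Set ℂ) := by
    rw [Filter.eventuallyEq_univ]
    exact compl_mem_ae_iff.2 P.volume_loop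
  have hae : P.windingNumber =ᵐ[volume] fun p => ∑ i,
      ((ccwTriangle (P.point i) (P.point (finRotate P.d i))).indicator (fun _ => (1 : ℝ)) p -
        (ccwTriangle (P.point (finRotate P.d i)) (P.point i)).indicator (fun _ => (1 : ℝ)) p) := by
    have h0 : ∀ᵐ p : ℂ, ∀ i, p ∉ segment ℝ 0 (P.point i) :=
      ae_all_iff.2 fun i => measure_eq_zero_iff_ae_notMem.1 (volume_segment _ _)
    have hs : ∀ᵐ p : ℂ, p ∉ P.loop := measure_eq_zero_iff_ae_notMem.1 P.volume_loop
    filter_upwards [h0, hs] with p hp0 hps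
    exact P.windingNumber_eq_sum hp0 hps
  rw [A, setIntegral_congr_set hfull, setIntegral_univ, integral_congr_ae hae, integral_finsetSum,
    Finset.sum_div]
  · exact Finset.sum_congr rfl fun i _ => integral_indicator_ccwTriangle_sub _ _
  · exact fun i _ =>
      (integrable_indicator_ccwTriangle _ _).sub (integrable_indicator_ccwTriangle _ _)

end LatticeMultiPolygon

/-! ### Lattice points on a segment -/

lemma latticePoint_injective : Function.Injective latticePoint := by
  rintro ⟨a, b⟩ ⟨c, d⟩ h
  have h1 := congrArg Complex.re h
  have h2 := congrArg Complex.im h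
  simp only [latticePoint, Int.cast_inj] at h1 h2
  rw [h1, h2]

/-- The greatest common divisor of the coordinates of `q - p`; for `p ≠ q` it is one less than the
number of lattice points on the segment from `p` to `q`. -/
def latticeLength (p q : ℤ × ℤ) : ℕ := Int.gcd (q.1 - p.1) (q.2 - p.2)

lemma latticePoint_mem_segment_iff (a b x : ℤ × ℤ) :
    latticePoint x ∈ segment ℝ (latticePoint a) (latticePoint b) ↔
      ∃ t : ℝ, 0 ≤ t ∧ t ≤ 1 ∧ ((x.1 : ℝ) - a.1 = t * (b.1 - a.1)) ∧
        ((x.2 : ℝ) - a.2 = t * (b.2 - a.2)) := by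
  rw [segment_eq_image']
  constructor
  · rintro ⟨t, ⟨h0, h1⟩, h⟩
    have e1 := congrArg Complex.re h
    have e2 := congrArg Complex.im h
    simp [latticePoint] at e1 e2
    exact ⟨t, h0, h1, by linarith, by linarith⟩
  · rintro ⟨t, h0, h1, e1, e2⟩
    refine ⟨t, ⟨h0, h1⟩, ?_⟩
    apply Complex.ext <;> simp [latticePoint] <;> linarith

lemma ncard_lattice_segment {a b : ℤ × ℤ} (hab : a ≠ b) :
    {x : ℤ × ℤ | latticePoint x ∈ segment ℝ (latticePoint a) (latticePoint b)}.ncard =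
      latticeLength a b + 1 := by
  have hg : 0 < latticeLength a b := by
    rw [latticeLength, Int.gcd_pos_iff]
    by_contra hcon
    apply hab
    ext <;> omega
  obtain ⟨p, q, hpq, hp, hq⟩ := Int.exists_gcd_one hg
  change _ = p * (latticeLength a b : ℤ) at hp
  change _ = q * (latticeLength a b : ℤ) at hq
  set g := latticeLength a b with hgdef
  have hg0 : (0 : ℝ) < g := by exact_mod_cast hg
  have hpR : (b.1 : ℝ) - a.1 = p * g := by exact_mod_cast hp
  have hqR : (b.2 : ℝ) - a.2 = q * g := by exact_mod_cast hq
  have hbez : p * Int.gcdA p q + q * Int.gcdB p q = 1 := by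
    rw [← Int.gcd_eq_gcd_ab, hpq]; rfl
  have hbezR : (p : ℝ) * Int.gcdA p q + q * Int.gcdB p q = 1 := by exact_mod_cast hbez
  let f : ℕ → ℤ × ℤ := fun k => (a.1 + k * p, a.2 + k * q)
  have hset : {x : ℤ × ℤ | latticePoint x ∈ segment ℝ (latticePoint a) (latticePoint b)} =
      f '' (Finset.range (g + 1) : Set ℕ) := by
    ext x
    rw [Set.mem_ofPred_eq, latticePoint_mem_segment_iff, hpR, hqR]
    constructor
    · rintro ⟨t, h0, h1, e1, e2⟩
      -- By Bézout, the multiple of `(p, q)` by which `x` differs from `a` is an integer.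
      set k : ℤ := (x.1 - a.1) * Int.gcdA p q + (x.2 - a.2) * Int.gcdB p q with hk
      have hkR : (k : ℝ) = t * g := by
        rw [hk]
        push_cast
        rw [e1, e2]
        linear_combination t * g * hbezR
      have hk0 : 0 ≤ k := by
        have : (0 : ℝ) ≤ k := by rw [hkR]; positivity
        exact_mod_cast this
      have hkg : k ≤ g := by
        have : (k : ℝ) ≤ g := by rw [hkR]; nlinarith
        exact_mod_cast this
      have x1 : x.1 - a.1 = k * p := by
        have : (x.1 : ℝ) - a.1 = k * p := by rw [hkR, e1]; ring
        exact_mod_cast this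
      have x2 : x.2 - a.2 = k * q := by
        have : (x.2 : ℝ) - a.2 = k * q := by rw [hkR, e2]; ring
        exact_mod_cast this
      refine ⟨k.toNat, ?_, ?_⟩
      · simp only [Finset.coe_range, Set.mem_Iio]
        omega
      · have hc : ((k.toNat : ℕ) : ℤ) = k := Int.toNat_of_nonneg hk0
        simp only [f, hc]
        ext
        · simp only; omega
        · simp only; omega
    · rintro ⟨k, hk, rfl⟩
      simp only [Finset.coe_range, Set.mem_Iio] at hk
      have hkR : (k : ℝ) ≤ g := by exact_mod_cast Nat.lt_succ_iff.1 hk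
      refine ⟨k / g, by positivity, (div_le_one hg0).2 hkR, ?_, ?_⟩
      · simp only [f]; push_cast; field_simp; ring
      · simp only [f]; push_cast; field_simp; ring
  have hinj : Function.Injective f := by
    intro k l hkl
    simp only [f, Prod.mk.injEq, add_right_inj] at hkl
    have : (k : ℤ) = l := by
      linear_combination Int.gcdA p q * hkl.1 + Int.gcdB p q * hkl.2 - ((k : ℤ) - l) * hbez
    exact_mod_cast this
  rw [hset, Set.ncard_image_of_injective _ hinj, Set.ncard_coe_finset, Finset.card_range]

/-- The greatest common divisor of two integers is even only if both are. -/
lemma gcd_modEq_two (x y : ℤ) : (Int.gcd x y : ℤ) ≡ x + y + x * y [ZMOD 2] := by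
  have h : (2 : ℤ) ∣ Int.gcd x y ↔ 2 ∣ x ∧ 2 ∣ y := Int.dvd_coe_gcd_iff
  have key : (2 : ℤ) ∣ x + y + x * y ↔ 2 ∣ x ∧ 2 ∣ y := by
    have e : x + y + x * y = (x + 1) * (y + 1) - 1 := by ring
    rw [e]
    simp only [← even_iff_two_dvd, Int.even_sub, Int.even_mul, Int.even_add, Int.not_even_one]
    tauto
  have e := h.trans key.symm
  unfold Int.ModEq
  omega

/-- The determinant of two vectors with integer coordinates. -/
def latticeWedge (p q : ℤ × ℤ) : ℤ := p.1 * q.2 - p.2 * q.1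

lemma wedge_latticePoint (p q : ℤ × ℤ) :
    wedge (latticePoint p) (latticePoint q) = latticeWedge p q := by
  simp [wedge, latticePoint, latticeWedge]

/-! ### The normal vectors -/

/-- The normal vector of the side from `p` to `q` with sign `s`. -/
def sideNormal (s : ℤˣ) (p q : ℤ × ℤ) : ℂ :=
  ((s : ℤ) : ℂ) * (-Complex.I * (latticePoint q - latticePoint p))

lemma sideNormal_ne_zero {s : ℤˣ} {p q : ℤ × ℤ} (h : p ≠ q) : sideNormal s p q ≠ 0 := by
  unfold sideNormal
  refine mul_ne_zero (by exact_mod_cast s.ne_zero) (mul_ne_zero (by simp) ?_)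
  rw [sub_ne_zero]
  exact fun e => h (latticePoint_injective e).symm

lemma wedge_sideNormal (s t : ℤˣ) (p q r u : ℤ × ℤ) :
    wedge (sideNormal s p q) (sideNormal t r u) =
      ((s * t * latticeWedge (q - p) (u - r) : ℤ) : ℝ) := by
  simp [wedge, sideNormal, latticePoint, latticeWedge]
  ring

namespace LatticeMultiPolygon

variable (P : LatticeMultiPolygon)

/-- The sum `∑ vᵢ × vᵢ₊₁` of the shoelace formula, which is twice the area. -/
def doubleArea : ℤ := ∑ i, latticeWedge (P.vertex i) (P.vertex (finRotate P.d i))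

lemma A_eq_doubleArea : P.A = (P.doubleArea : ℝ) / 2 := by
  rw [A_eq_sum_wedge, doubleArea, Int.cast_sum]
  simp only [← wedge_latticePoint]
  rfl

lemma sideLength_eq (i : Fin P.d) :
    P.sideLength i = latticeLength (P.vertex i) (P.vertex (finRotate P.d i)) := by
  unfold sideLength side point
  rw [ncard_lattice_segment (P.vertex_ne i)]
  simp

lemma B_eq : P.B = ∑ i, (P.sign i : ℤ) *
    latticeLength (P.vertex i) (P.vertex (finRotate P.d i)) := by
  simp only [B, sideLength_eq]

lemma normal_ne_zero (i : Fin P.d) : P.normal i ≠ 0 :=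
  sideNormal_ne_zero (P.vertex_ne i)

lemma even_doubleArea_add_B : Even (P.doubleArea + P.B) := by
  rw [even_iff_two_dvd, ← Int.modEq_zero_iff_dvd, doubleArea, B_eq, ← Finset.sum_add_distrib]
  -- Modulo `2` each summand is a difference of values of functions at the two end points.
  have key : ∀ i, latticeWedge (P.vertex i) (P.vertex (finRotate P.d i)) +
      (P.sign i : ℤ) * latticeLength (P.vertex i) (P.vertex (finRotate P.d i)) ≡
      ((P.vertex (finRotate P.d i)).1 + (P.vertex (finRotate P.d i)).2 +
        (P.vertex (finRotate P.d i)).1 * (P.vertex (finRotate P.d i)).2) -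
      ((P.vertex i).1 + (P.vertex i).2 + (P.vertex i).1 * (P.vertex i).2) [ZMOD 2] := by
    intro i
    have hg := gcd_modEq_two ((P.vertex (finRotate P.d i)).1 - (P.vertex i).1)
      ((P.vertex (finRotate P.d i)).2 - (P.vertex i).2)
    have hs : (P.sign i : ℤ) ≡ 1 [ZMOD 2] := by
      rcases Int.units_eq_one_or (P.sign i) with h | h <;> rw [h] <;> decide
    refine ((hs.mul hg).add_left _).trans ?_
    unfold latticeWedge
    generalize P.vertex (finRotate P.d i) = w
    rw [Int.modEq_iff_dvd]
    exact ⟨(w.1 - (P.vertex i).1) * (P.vertex i).2, by ring⟩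
  have hsum := Int.ModEq.sum (n := 2) (s := Finset.univ) fun i _ => key i
  refine hsum.trans ?_
  rw [Finset.sum_sub_distrib, Equiv.sum_comp (finRotate P.d)
    (fun i => (P.vertex i).1 + (P.vertex i).2 + (P.vertex i).1 * (P.vertex i).2), sub_self]

end LatticeMultiPolygon

/-! ### Concatenation of loops with a common first side -/

/-- The conditions on three consecutive vertices `p`, `q`, `r` of a lattice multi-polygon, where
`s` and `t` are the signs of the sides `pq` and `qr`. -/
structure IsSignedCorner (p q r : ℤ × ℤ) (s t : ℤˣ) : Prop where
  ne : p ≠ q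
  sign_eq : latticePoint q ∈ segment ℝ (latticePoint p) (latticePoint r) → s = t
  sign_ne : latticePoint p ∈ segment ℝ (latticePoint q) (latticePoint r) ∨
    latticePoint r ∈ segment ℝ (latticePoint p) (latticePoint q) → s ≠ t

/-- The vertices and signs `V 0, …, V (d - 1)` are those of a lattice multi-polygon, which starts
with the side from `(0, 0)` to `(1, 0)`, with sign `+`, and which has twice the area equal to `k`,
signed lattice length `l` and rotation number `m`. The sequence is continued by
`V d = V 0` and by the vertex of `V 1` at `d + 1`, and its later terms are arbitrary. -/
structure IsBasedLoop (V : ℕ → (ℤ × ℤ) × ℤˣ) (d : ℕ) (k l m : ℤ) : Prop where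
  two_le : 2 ≤ d
  zero : V 0 = ((0, 0), 1)
  one : (V 1).1 = (1, 0)
  last : V d = V 0
  last_succ : (V (d + 1)).1 = (V 1).1
  corner : ∀ i < d, IsSignedCorner (V i).1 (V (i + 1)).1 (V (i + 2)).1 (V i).2 (V (i + 1)).2
  area : ∑ i ∈ Finset.range d, latticeWedge (V i).1 (V (i + 1)).1 = k
  length : ∑ i ∈ Finset.range d, ((V i).2 : ℤ) * latticeLength (V i).1 (V (i + 1)).1 = l
  turning : ∑ i ∈ Finset.range d, turn (sideNormal (V i).2 (V i).1 (V (i + 1)).1)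
    (sideNormal (V (i + 1)).2 (V (i + 1)).1 (V (i + 2)).1) = 2 * Real.pi * m

/-- There is a lattice multi-polygon starting with the side from `(0, 0)` to `(1, 0)`, with sign
`+`, with twice the area `k`, signed lattice length `l` and rotation number `m`. -/
def Attained (k l m : ℤ) : Prop := ∃ V d, IsBasedLoop V d k l m

/-- Running through two loops one after the other adds their invariants: as the first sides agree,
the corner between the loops is the one at which the first loop closes. -/
lemma Attained.add {k l m k' l' m' : ℤ} (h : Attained k l m) (h' : Attained k' l' m') :
    Attained (k + k') (l + l') (m + m') := by
  obtain ⟨V, d, hV⟩ := h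
  obtain ⟨W, e, hW⟩ := h'
  let U : ℕ → (ℤ × ℤ) × ℤˣ := fun i => if i < d then V i else W (i - d)
  have hd := hV.two_le
  have he := hW.two_le
  have hU₁ : ∀ i ≤ d, U i = V i := by
    intro i hi
    rcases hi.lt_or_eq with h | rfl
    · simp [U, h]
    · simp [U, hV.last, hV.zero, hW.zero]
  have hU₂ : ∀ i, U (d + i) = W i := by
    intro i
    simp [U]
  have hU₁' : ∀ i ≤ d + 1, (U i).1 = (V i).1 := by
    intro i hi
    rcases Nat.le_succ_iff.1 hi with h | rfl
    · rw [hU₁ i h]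
    · rw [Nat.succ_eq_add_one, hU₂, hV.last_succ, hV.one, hW.one]
  have hU₂' : ∀ i j, U (d + i + j) = W (i + j) := fun i j => by rw [add_assoc, hU₂]
  refine ⟨U, d + e, by omega, ?_, ?_, ?_, ?_, ?_, ?_, ?_, ?_⟩
  · rw [hU₁ 0 (by omega), hV.zero]
  · rw [hU₁' 1 (by omega), hV.one]
  · rw [hU₂, hU₁ 0 (by omega), hW.last, hW.zero, hV.zero]
  · rw [hU₂', hU₁' 1 (by omega), hW.last_succ, hW.one, hV.one]
  · intro i hi
    rcases lt_or_ge i d with h | h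
    · rw [hU₁ i (by omega), hU₁ (i + 1) (by omega), hU₁' (i + 2) (by omega)]
      exact hV.corner i h
    · obtain ⟨j, rfl⟩ := Nat.exists_eq_add_of_le h
      rw [hU₂, hU₂', hU₂']
      exact hW.corner j (by omega)
  · rw [Finset.sum_range_add, ← hV.area, ← hW.area]
    congr 1
    · refine Finset.sum_congr rfl fun i hi => ?_
      rw [Finset.mem_range] at hi
      rw [hU₁ i (by omega), hU₁ (i + 1) (by omega)]
    · refine Finset.sum_congr rfl fun i _ => ?_
      rw [hU₂, hU₂']
  · rw [Finset.sum_range_add, ← hV.length, ← hW.length]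
    congr 1
    · refine Finset.sum_congr rfl fun i hi => ?_
      rw [Finset.mem_range] at hi
      rw [hU₁ i (by omega), hU₁ (i + 1) (by omega)]
    · refine Finset.sum_congr rfl fun i _ => ?_
      rw [hU₂, hU₂']
  · rw [Finset.sum_range_add, Int.cast_add, mul_add, ← hV.turning, ← hW.turning]
    congr 1
    · refine Finset.sum_congr rfl fun i hi => ?_
      rw [Finset.mem_range] at hi
      rw [hU₁ i (by omega), hU₁ (i + 1) (by omega), hU₁' (i + 2) (by omega)]
    · refine Finset.sum_congr rfl fun i _ => ?_
      rw [hU₂, hU₂', hU₂']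

lemma IsBasedLoop.comp_finRotate {V : ℕ → (ℤ × ℤ) × ℤˣ} {d : ℕ} {k l m : ℤ}
    (h : IsBasedLoop V d k l m) (i : Fin d) : V (finRotate d i) = V (i + 1) := by
  obtain ⟨n, rfl⟩ : ∃ n, d = n + 1 := ⟨d - 1, by have := h.two_le; omega⟩
  rw [coe_finRotate]
  split_ifs with hi
  · rw [hi, Fin.val_last, h.last]
  · rfl

lemma IsBasedLoop.comp_finRotate_finRotate {V : ℕ → (ℤ × ℤ) × ℤˣ} {d : ℕ} {k l m : ℤ}
    (h : IsBasedLoop V d k l m) (i : Fin d) :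
    (V (finRotate d (finRotate d i))).1 = (V (i + 2)).1 := by
  rw [h.comp_finRotate]
  obtain ⟨n, rfl⟩ : ∃ n, d = n + 1 := ⟨d - 1, by have := h.two_le; omega⟩
  rw [coe_finRotate]
  split_ifs with hi
  · rw [hi, Fin.val_last, zero_add, ← h.last_succ]
  · rfl

/-- The lattice multi-polygon given by a based loop. -/
def IsBasedLoop.toLatticeMultiPolygon {V : ℕ → (ℤ × ℤ) × ℤˣ} {d : ℕ} {k l m : ℤ}
    (h : IsBasedLoop V d k l m) : LatticeMultiPolygon where
  d := d
  two_le := h.two_le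
  vertex i := (V i).1
  sign i := (V i).2
  vertex_ne i := by
    rw [h.comp_finRotate]
    exact (h.corner i i.2).ne
  sign_eq i := by
    rw [h.comp_finRotate_finRotate, h.comp_finRotate]
    exact (h.corner i i.2).sign_eq
  sign_ne i := by
    rw [h.comp_finRotate_finRotate, h.comp_finRotate]
    exact (h.corner i i.2).sign_ne

lemma Attained.exists_latticeMultiPolygon {k l m : ℤ} (h : Attained k l m) :
    ∃ P : LatticeMultiPolygon, P.A = (k : ℝ) / 2 ∧ P.B = l ∧ P.C = m := by
  obtain ⟨V, d, hV⟩ := h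
  refine ⟨hV.toLatticeMultiPolygon, ?_, ?_, ?_⟩
  · rw [LatticeMultiPolygon.A_eq_doubleArea]
    congr 2
    refine Eq.trans ?_ hV.area
    rw [← Fin.sum_univ_eq_sum_range]
    refine Finset.sum_congr rfl fun (i : Fin d) _ => ?_
    rw [← hV.comp_finRotate]
    rfl
  · rw [LatticeMultiPolygon.B_eq]
    refine Eq.trans ?_ hV.length
    rw [← Fin.sum_univ_eq_sum_range]
    refine Finset.sum_congr rfl fun (i : Fin d) _ => ?_
    rw [← hV.comp_finRotate]
    rfl
  · rw [LatticeMultiPolygon.C, rotationNumber_eq_sum_turn, div_eq_iff Real.two_pi_pos.ne', mul_comm]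
    refine Eq.trans ?_ hV.turning
    rw [← Fin.sum_univ_eq_sum_range]
    refine Finset.sum_congr rfl fun (i : Fin d) _ => ?_
    rw [← hV.comp_finRotate_finRotate, ← hV.comp_finRotate]
    rfl

/-! ### Triangles, and the values attained -/

/-- At a corner whose sides are not parallel the conditions on the signs are vacuous. -/
lemma isSignedCorner_of_latticeWedge_ne_zero {p q r : ℤ × ℤ} (h : latticeWedge (q - p) (r - q) ≠ 0)
    (s t : ℤˣ) : IsSignedCorner p q r s t := by
  have hcol : ∀ a b c : ℤ × ℤ, latticePoint b ∈ segment ℝ (latticePoint a) (latticePoint c) →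
      latticeWedge (b - a) (c - b) = 0 := by
    intro a b c hb
    obtain ⟨x, -, -, h1, h2⟩ := (latticePoint_mem_segment_iff a c b).1 hb
    have : (((b.1 - a.1) * (c.2 - b.2) - (b.2 - a.2) * (c.1 - b.1) : ℤ) : ℝ) = 0 := by
      push_cast
      linear_combination ((c.2 : ℝ) - a.2) * h1 - ((c.1 : ℝ) - a.1) * h2
    exact_mod_cast this
  refine ⟨?_, fun hq => absurd (hcol _ _ _ hq) h, ?_⟩
  · rintro rfl
    simp [latticeWedge] at h
  · rintro (hp | hr)
    · refine absurd ?_ h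
      have := hcol _ _ _ hp
      simp only [latticeWedge, Prod.fst_sub, Prod.snd_sub] at *
      linarith
    · refine absurd ?_ h
      have := hcol _ _ _ hr
      simp only [latticeWedge, Prod.fst_sub, Prod.snd_sub] at *
      linarith

/-- The triangle with vertices `(0, 0)`, `(1, 0)`, `(0, y)`, where `y = ±1`, and with signs
`1, s, t`. The normals turn in the same direction at all corners, and so make a full turn, only if
`s = t = 1`. -/
lemma attained_triangle (y s t : ℤˣ) :
    Attained y (1 + s + t) (if s = 1 ∧ t = 1 then y else 0) := by
  let V : ℕ → (ℤ × ℤ) × ℤˣ := fun i =>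
    if i % 3 = 0 then ((0, 0), 1) else if i % 3 = 1 then ((1, 0), s) else ((0, (y : ℤ)), t)
  have h0 : V 0 = ((0, 0), 1) := by simp [V]
  have h1 : V 1 = ((1, 0), s) := by simp [V]
  have h2 : V 2 = ((0, (y : ℤ)), t) := by simp [V]
  have h3 : V 3 = ((0, 0), 1) := by simp [V]
  have h4 : V 4 = ((1, 0), s) := by simp [V]
  refine ⟨V, 3, by norm_num, h0, by rw [h1], by rw [h3], by rw [h4], ?_, ?_, ?_, ?_⟩
  · intro i hi
    apply isSignedCorner_of_latticeWedge_ne_zero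
    interval_cases i <;> simp [h0, h1, h2, h3, h4, latticeWedge]
  · simp [Finset.sum_range_succ, h0, h1, h2, h3, latticeWedge]
  · rcases Int.units_eq_one_or y with rfl | rfl <;>
      simp [Finset.sum_range_succ, h0, h1, h2, h3, latticeLength]
  · set n₀ := sideNormal 1 (0, 0) (1, 0) with hn₀
    set n₁ := sideNormal s (1, 0) (0, y) with hn₁
    set n₂ := sideNormal t (0, y) (0, 0) with hn₂
    have w₀ : wedge n₀ n₁ = ((s * y : ℤ) : ℝ) := by
      rw [hn₀, hn₁, wedge_sideNormal]
      simp [latticeWedge]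
    have w₁ : wedge n₁ n₂ = ((s * t * y : ℤ) : ℝ) := by
      rw [hn₁, hn₂, wedge_sideNormal]
      simp [latticeWedge]
    have w₂ : wedge n₂ n₀ = ((t * y : ℤ) : ℝ) := by
      rw [hn₂, hn₀, wedge_sideNormal]
      simp [latticeWedge]
    have hturn := turn_add_turn_add_turn (u := n₀) (v := n₁) (w := n₂)
      (sideNormal_ne_zero (by simp)) (sideNormal_ne_zero (by simp)) (sideNormal_ne_zero (by simp))
      (turn_ne_pi_of_wedge_ne_zero (by rw [w₀]; simp))
      (turn_ne_pi_of_wedge_ne_zero (by rw [w₁]; simp))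
      (turn_ne_pi_of_wedge_ne_zero (by rw [w₂]; simp))
    rw [w₀, w₁, w₂] at hturn
    simp only [Finset.sum_range_succ, Finset.sum_range_zero, zero_add, h0, h1, h2, h3, h4,
      Nat.reduceAdd, ← hn₀, ← hn₁, ← hn₂]
    rw [hturn]
    congr 1
    rcases Int.units_eq_one_or y with rfl | rfl <;> rcases Int.units_eq_one_or s with rfl | rfl <;>
      rcases Int.units_eq_one_or t with rfl | rfl <;> norm_num

lemma Attained.add_nsmul {k l m k' l' m' : ℤ} (h : Attained k l m) (h' : Attained k' l' m')
    (n : ℕ) : Attained (k + n * k') (l + n * l') (m + n * m') := by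
  induction n with
  | zero => simpa using h
  | succ n ih =>
    convert ih.add h' using 1 <;> push_cast <;> ring

/-- A multiple of `(k', l', m')`, of any sign, may be added if both it and its negative can. -/
lemma Attained.add_zsmul {k l m k' l' m' : ℤ} (h : Attained k l m)
    (h' : Attained k' l' m') (h'' : Attained (-k') (-l') (-m')) (n : ℤ) :
    Attained (k + n * k') (l + n * l') (m + n * m') := by
  obtain ⟨j, rfl | rfl⟩ := n.eq_nat_or_neg
  · exact_mod_cast h.add_nsmul h' j
  · convert h.add_nsmul h'' j using 1 <;> ring

/-- Sums of the values `(±1, ±1, 0)` and `(±1, 3, ±1)` of triangles, the last with equal signs, make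
up all triples `(k, l, m)` for which `k + l` is even. -/
lemma attained_of_even {k l : ℤ} (m : ℤ) (h : Even (k + l)) : Attained k l m := by
  have h₁ : Attained 1 1 0 := by simpa using attained_triangle 1 1 (-1)
  have h₂ : Attained 1 (-1) 0 := by simpa using attained_triangle 1 (-1) (-1)
  have h₃ : Attained (-1) 1 0 := by simpa using attained_triangle (-1) 1 (-1)
  have h₄ : Attained (-1) (-1) 0 := by simpa using attained_triangle (-1) (-1) (-1)
  have h₅ : Attained 1 3 1 := by simpa using attained_triangle 1 1 1
  have h₆ : Attained (-1) 3 (-1) := by simpa using attained_triangle (-1) 1 1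
  -- `-(1, 3, 1) = (-1, 3, -1) + 3 (1, -1, 0) + 3 (-1, -1, 0)`
  have h₇ : Attained (-1) (-3) (-1) := by simpa using (h₆.add_nsmul h₂ 3).add_nsmul h₄ 3
  obtain ⟨r, hr⟩ := h
  have h₀ : Attained 0 0 0 := h₁.add h₄
  have hfin := ((h₀.add_zsmul h₅ h₇ m).add_zsmul h₁ h₄ (r - 2 * m)).add_zsmul h₂ h₃ (k - r + m)
  convert hfin using 1
  · ring
  · linear_combination hr
  · ring

theorem theorem4p1 (a b c : ℝ) :
    (∃ P : LatticeMultiPolygon, (a, b, c) = (P.A, (P.B : ℝ) / 2, P.C)) ↔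
      (∃ k : ℤ, a = (k : ℝ) / 2) ∧ (∃ l : ℤ, b = (l : ℝ) / 2) ∧ (∃ m : ℤ, c = (m : ℝ)) ∧
        ∃ n : ℤ, a + b = (n : ℝ) := by
  constructor
  · rintro ⟨P, hP⟩
    simp only [Prod.mk.injEq] at hP
    obtain ⟨rfl, rfl, rfl⟩ := hP
    refine ⟨⟨_, P.A_eq_doubleArea⟩, ⟨_, rfl⟩,
      exists_rotationNumber_eq_intCast _ P.normal_ne_zero, ?_⟩
    obtain ⟨n, hn⟩ := P.even_doubleArea_add_B
    refine ⟨n, ?_⟩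
    have hnR : (P.doubleArea : ℝ) + P.B = n + n := by exact_mod_cast hn
    rw [P.A_eq_doubleArea]
    linarith
  · rintro ⟨⟨k, rfl⟩, ⟨l, rfl⟩, ⟨m, rfl⟩, n, hn⟩
    have hkl : Even (k + l) := by
      refine ⟨n, ?_⟩
      have : (k : ℝ) + l = n + n := by linarith
      exact_mod_cast this
    obtain ⟨P, hA, hB, hC⟩ := (attained_of_even m hkl).exists_latticeMultiPolygon
    exact ⟨P, by rw [hA, hB, hC]⟩
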